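/- Let $Q$ be a finite directed graph with vertex set $V(Q)$, edge set $E(Q)$ and range and source maps $r,s:E(Q)\to V(Q)$ (loops and parallel edges are allowed), and put $r(v)=v=s(v)$ for $v\in V(Q)$. Let $w(Q)$ be the semigroup of all nonempty finite words in $V(Q)\cup E(Q)$ subject to the relations $r(x)\,x=x=x\,s(x)$ for every $x\in V(Q)\cup E(Q)$. A contractive representation of $Q$ on a complex Hilbert space $H$ assigns to every vertex $v$ an orthogonal projection $P_v\in B(H)$ (different $P_v$ need not be mutually orthogonal) and to every edge $e$ a contraction $T_e\in B(H)$ with $P_{r(e)}T_e=T_e=T_eP_{s(e)}$; it induces a homomorphism of the semigroup algebra $\mathbb{C}w(Q)$ into $B(H)$. The universal operator algebra $OA(Q)$, a Banach algebra that need not be unital, is the completion of $\mathbb{C}w(Q)$ in the norm $\|x\|=\sup_\pi\|\pi(x)\|$, the supremum being over all contractive representations $\pi$ of $Q$ on Hilbert spaces. Let $M_{OA(Q)}$ be its maximal ideal space, that is, the set of nonzero multiplicative linear functionals $OA(Q)\to\mathbb{C}$ with the weak-$*$ topology. For nonempty $S\subseteq V(Q)$ let $n(S)$ be the number of edges $e$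 with $r(e)\in S$ and $s(e)\in S$, and let $\overline{\mathbb{D}}^{k}$ be the product of $k$ copies of the closed unit disc in $\mathbb{C}$ (a single point if $k=0$). Then $M_{OA(Q)}$ is homeomorphic to the disjoint union \[\bigsqcup_{\emptyset\neq S\subseteq V(Q)}\overline{\mathbb{D}}^{\,n(S)}.\] -/

import Mathlib

universe u v w

/-- A directed graph with vertex type `V` and edge type `E`: every edge has a range and a source.
Loops and parallel edges are allowed. -/
structure DirectedGraph (V : Type u) (E : Type v) where
  /-- the range of an edge -/
  r : E → V
  /-- the source of an edge -/
  s : E → V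

namespace DirectedGraph

noncomputable section

variable {V : Type u} {E : Type v} (Q : DirectedGraph V E)

/-- The range map extended to letters, with `r v = v` on vertices. -/
def range : V ⊕ E → V := Sum.elim id Q.r

/-- The source map extended to letters, with `s v = v` on vertices. -/
def source : V ⊕ E → V := Sum.elim id Q.s

/-- The relations `r(x) x = x` and `x s(x) = x` between (nonempty) words in vertices and edges. -/
inductive WordRel : FreeSemigroup (V ⊕ E) → FreeSemigroup (V ⊕ E) → Prop
  | range_mul (x : V ⊕ E) :
      WordRel (FreeSemigroup.of (Sum.inl (Q.range x)) * FreeSemigroup.of x) (FreeSemigroup.of x)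
  | mul_source (x : V ⊕ E) :
      WordRel (FreeSemigroup.of x * FreeSemigroup.of (Sum.inl (Q.source x))) (FreeSemigroup.of x)

/-- The congruence on words generated by the relations. -/
def wordCon : Con (FreeSemigroup (V ⊕ E)) := conGen Q.WordRel

/-- The semigroup `w(Q)` of all nonempty words in the vertices and edges of `Q`, subject to
`r(x) x = x = x s(x)` for every vertex or edge `x`. -/
abbrev Words : Type (max u v) := Q.wordCon.Quotient

/-- A contractive representation of `Q` on a Hilbert space: vertices go to (orthogonal)
projections, not assumed to be mutually orthogonal, edges go to contractions, and
`r(e) e = e = e s(e)` is respected. -/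
structure ContractiveRep (H : Type w) [NormedAddCommGroup H] [InnerProductSpace ℂ H]
    [CompleteSpace H] where
  /-- the projection of a vertex -/
  P : V → H →L[ℂ] H
  /-- the contraction of an edge -/
  T : E → H →L[ℂ] H
  isStarProjection (v : V) : IsStarProjection (P v)
  norm_le_one (e : E) : ‖T e‖ ≤ 1
  range_mul (e : E) : P (Q.r e) * T e = T e
  mul_source (e : E) : T e * P (Q.s e) = T e

namespace ContractiveRep

variable {Q} {H : Type w} [NormedAddCommGroup H] [InnerProductSpace ℂ H] [CompleteSpace H]
  (π : Q.ContractiveRep H)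

/-- The induced multiplicative map on free words. -/
def onFree : FreeSemigroup (V ⊕ E) →ₙ* (H →L[ℂ] H) := FreeSemigroup.lift (Sum.elim π.P π.T)

theorem onFree_eq {x y : FreeSemigroup (V ⊕ E)} (h : Q.wordCon x y) :
    π.onFree x = π.onFree y := by
  induction h with
  | of x y h =>
    rcases h with ⟨v | e⟩ | ⟨v | e⟩
    · simpa [onFree, range] using (π.isStarProjection v).isIdempotentElem.eq
    · simpa [onFree, range] using π.range_mul e
    · simpa [onFree, source] using (π.isStarProjection v).isIdempotentElem.eq
    · simpa [onFree, source] using π.mul_source e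
  | refl x => rfl
  | symm _ ih => exact ih.symm
  | trans _ _ ih₁ ih₂ => exact ih₁.trans ih₂
  | mul _ _ ih₁ ih₂ => rw [map_mul, map_mul, ih₁, ih₂]

/-- The induced representation of the semigroup `w(Q)`. -/
def onWords : Q.Words →ₙ* (H →L[ℂ] H) where
  toFun x := Con.liftOn x π.onFree fun _ _ h => π.onFree_eq h
  map_mul' x y := Con.induction_on₂ x y fun a b => map_mul π.onFree a b

/-- The induced representation of the semigroup algebra `ℂ w(Q)`. -/
def onAlgebra : MonoidAlgebra ℂ Q.Words →ₙₐ[ℂ] (H →L[ℂ] H) :=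
  MonoidAlgebra.liftMagma ℂ π.onWords

theorem norm_onWords_le (x : Q.Words) : ‖π.onWords x‖ ≤ 1 := by
  induction x using Con.induction_on with
  | H x =>
    change ‖π.onFree x‖ ≤ 1
    have key : ∀ x : V ⊕ E, ‖π.onFree (FreeSemigroup.of x)‖ ≤ 1 := by
      rintro (v | e)
      · simpa [onFree] using (π.isStarProjection v).norm_le
      · simpa [onFree] using π.norm_le_one e
    induction x with
    | ih1 x => exact key x
    | ih2 x y hx hy =>
      rw [map_mul]
      exact (norm_mul_le _ _).trans (mul_le_one₀ hx (norm_nonneg _) hy)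

theorem norm_onAlgebra_le (x : MonoidAlgebra ℂ Q.Words) :
    ‖π.onAlgebra x‖ ≤ x.coeff.sum fun _ c => ‖c‖ := by
  have h : π.onAlgebra x = x.coeff.sum fun g c => c • π.onWords g := by
    simp only [onAlgebra, MonoidAlgebra.liftMagma_apply_apply]
    rfl
  rw [h]
  refine (norm_sum_le _ _).trans (Finset.sum_le_sum fun g _ => ?_)
  rw [norm_smul]
  exact mul_le_of_le_one_right (norm_nonneg _) (π.norm_onWords_le g)

end ContractiveRep

/-- The semigroup algebra `ℂ w(Q)`, to be normed by the universal operator norm. -/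
def WordAlgebra : Type (max u v) := MonoidAlgebra ℂ Q.Words

instance : NonUnitalRing Q.WordAlgebra := inferInstanceAs (NonUnitalRing (MonoidAlgebra ℂ Q.Words))
instance : Module ℂ Q.WordAlgebra := inferInstanceAs (Module ℂ (MonoidAlgebra ℂ Q.Words))
instance : IsScalarTower ℂ Q.WordAlgebra Q.WordAlgebra :=
  inferInstanceAs (IsScalarTower ℂ (MonoidAlgebra ℂ Q.Words) (MonoidAlgebra ℂ Q.Words))
instance : SMulCommClass ℂ Q.WordAlgebra Q.WordAlgebra :=
  inferInstanceAs (SMulCommClass ℂ (MonoidAlgebra ℂ Q.Words) (MonoidAlgebra ℂ Q.Words))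

variable {Q} in
/-- The representation of `ℂ w(Q)` induced by a contractive representation of `Q`. -/
def ContractiveRep.eval {H : Type w} [NormedAddCommGroup H] [InnerProductSpace ℂ H]
    [CompleteSpace H] (π : Q.ContractiveRep H) : Q.WordAlgebra →ₙₐ[ℂ] (H →L[ℂ] H) :=
  π.onAlgebra

/-- The norms `‖π(x)‖`, over all contractive representations `π` of `Q` on Hilbert spaces.
(By cutting down to separable, respectively small enough, invariant subspaces, Hilbert spaces in
the universe of the graph give the same supremum as Hilbert spaces in any larger one.) -/
def repNorms (x : Q.WordAlgebra) : Set ℝ :=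
  {c | ∃ (H : Type (max u v)) (_ : NormedAddCommGroup H) (_ : InnerProductSpace ℂ H)
    (_ : CompleteSpace H) (π : Q.ContractiveRep H), c = ‖π.eval x‖}

theorem repNorms_nonempty (x : Q.WordAlgebra) : (Q.repNorms x).Nonempty :=
  ⟨_, PUnit, inferInstance, inferInstance, inferInstance,
    ⟨fun _ => 0, fun _ => 0, fun _ => IsStarProjection.zero _, by simp, by simp, by simp⟩, rfl⟩

theorem repNorms_bddAbove (x : Q.WordAlgebra) : BddAbove (Q.repNorms x) := by
  refine ⟨(MonoidAlgebra.coeff x).sum fun _ c => ‖c‖, ?_⟩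
  rintro _ ⟨H, _, _, _, π, rfl⟩
  exact π.norm_onAlgebra_le x

/-- The universal operator norm on `ℂ w(Q)`: the supremum of `‖π(x)‖` over all contractive
representations `π` of `Q`. -/
def universalNorm (x : Q.WordAlgebra) : ℝ := sSup (Q.repNorms x)

variable {Q} in
theorem ContractiveRep.norm_eval_le {H : Type (max u v)} [NormedAddCommGroup H]
    [InnerProductSpace ℂ H] [CompleteSpace H] (π : Q.ContractiveRep H) (x : Q.WordAlgebra) :
    ‖π.eval x‖ ≤ Q.universalNorm x :=
  le_csSup (Q.repNorms_bddAbove x) ⟨H, _, _, _, π, rfl⟩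

theorem universalNorm_le {x : Q.WordAlgebra} {C : ℝ}
    (h : ∀ (H : Type (max u v)) [NormedAddCommGroup H] [InnerProductSpace ℂ H] [CompleteSpace H]
      (π : Q.ContractiveRep H), ‖π.eval x‖ ≤ C) : Q.universalNorm x ≤ C := by
  refine csSup_le (Q.repNorms_nonempty x) ?_
  rintro _ ⟨H, _, _, _, π, rfl⟩
  exact h H π

theorem universalNorm_nonneg (x : Q.WordAlgebra) : 0 ≤ Q.universalNorm x := by
  refine Real.sSup_nonneg ?_
  rintro _ ⟨H, _, _, _, π, rfl⟩
  exact norm_nonneg _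

instance : SeminormedAddCommGroup Q.WordAlgebra :=
  AddGroupSeminorm.toSeminormedAddCommGroup
    { toFun := Q.universalNorm
      map_zero' := le_antisymm (Q.universalNorm_le fun H _ _ _ π => by simp)
        (Q.universalNorm_nonneg 0)
      add_le' := fun x y => Q.universalNorm_le fun H _ _ _ π => by
        rw [map_add]
        exact (norm_add_le _ _).trans (add_le_add (π.norm_eval_le x) (π.norm_eval_le y))
      neg' := fun x => by simp [universalNorm, repNorms] }

theorem norm_def (x : Q.WordAlgebra) : ‖x‖ = Q.universalNorm x := rfl

instance : NonUnitalSeminormedRing Q.WordAlgebra :=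
  { (inferInstance : SeminormedAddCommGroup Q.WordAlgebra),
    (inferInstance : NonUnitalRing Q.WordAlgebra) with
    norm_mul_le := fun x y => Q.universalNorm_le fun H _ _ _ π => by
      rw [map_mul]
      exact (norm_mul_le _ _).trans (mul_le_mul (π.norm_eval_le x) (π.norm_eval_le y)
        (norm_nonneg _) (Q.universalNorm_nonneg x)) }

instance : NormedSpace ℂ Q.WordAlgebra where
  norm_smul_le c x := Q.universalNorm_le fun H _ _ _ π => by
    rw [map_smul, norm_smul]
    exact mul_le_mul_of_nonneg_left (π.norm_eval_le x) (norm_nonneg c)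

/-- The universal operator algebra `OA(Q)` of the directed graph `Q`: the (Hausdorff) completion
of `ℂ w(Q)` in the universal operator norm. -/
def OA : Type (max u v) := UniformSpace.Completion Q.WordAlgebra

namespace OA

instance : NormedAddCommGroup Q.OA :=
  inferInstanceAs (NormedAddCommGroup (UniformSpace.Completion Q.WordAlgebra))
instance : NormedSpace ℂ Q.OA :=
  inferInstanceAs (NormedSpace ℂ (UniformSpace.Completion Q.WordAlgebra))
instance : CompleteSpace Q.OA :=
  inferInstanceAs (CompleteSpace (UniformSpace.Completion Q.WordAlgebra))

variable {Q} in
/-- The canonical map `ℂ w(Q) → OA(Q)`. -/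
def of : Q.WordAlgebra →L[ℂ] Q.OA := UniformSpace.Completion.toComplL

variable {Q} in
theorem norm_of (x : Q.WordAlgebra) : ‖of x‖ = ‖x‖ := UniformSpace.Completion.norm_coe x

theorem isDenseInducing_of : IsDenseInducing (of : Q.WordAlgebra → Q.OA) :=
  UniformSpace.Completion.isDenseInducing_coe

/-- Multiplication on `OA(Q)`: the continuous extension of the multiplication of `ℂ w(Q)`. -/
instance : Mul Q.OA :=
  ⟨fun a b => ((isDenseInducing_of Q).prodMap (isDenseInducing_of Q)).extend
    (fun p : Q.WordAlgebra × Q.WordAlgebra => of (p.1 * p.2)) (a, b)⟩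

variable {Q} in
theorem of_mul (x y : Q.WordAlgebra) : (of (x * y) : Q.OA) = of x * of y :=
  (((isDenseInducing_of Q).prodMap (isDenseInducing_of Q)).extend_eq
    (f := fun p : Q.WordAlgebra × Q.WordAlgebra => (of (p.1 * p.2) : Q.OA))
    (of.continuous.comp continuous_mul) (x, y)).symm

/-- Multiplication extends continuously along a dense additive map into a complete space. -/
theorem continuous_extend_mul {A B : Type*} [NonUnitalSeminormedRing A] [NormedAddCommGroup B]
    [CompleteSpace B] (j : A →+ B) (hj : IsDenseInducing j) :
    Continuous ((hj.prodMap hj).extend fun p : A × A => j (p.1 * p.2)) := by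
  let m : A →+ A →+ B := (AddMonoidHom.mul : A →+ A →+ A).compr₂ j
  have hm : Continuous fun p : A × A => m p.1 p.2 := hj.continuous.comp continuous_mul
  exact hj.extend_Z_bilin hj hm

instance : ContinuousMul Q.OA where
  continuous_mul :=
    continuous_extend_mul (of : Q.WordAlgebra →L[ℂ] Q.OA).toLinearMap.toAddMonoidHom
      (isDenseInducing_of Q)

variable {Q} in
theorem induction_on {p : Q.OA → Prop} (a : Q.OA) (hp : IsClosed {a | p a})
    (h : ∀ x : Q.WordAlgebra, p (of x)) : p a :=
  UniformSpace.Completion.induction_on a hp h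

section Algebra

variable {Q}

theorem zero_mul' (a : Q.OA) : 0 * a = 0 := by
  induction a using OA.induction_on with
  | hp => exact isClosed_eq (Continuous.mul continuous_const continuous_id) continuous_const
  | h x => rw [← map_zero (of : Q.WordAlgebra →L[ℂ] Q.OA), ← of_mul, zero_mul]

theorem mul_zero' (a : Q.OA) : a * 0 = 0 := by
  induction a using OA.induction_on with
  | hp => exact isClosed_eq (Continuous.mul continuous_id continuous_const) continuous_const
  | h x => rw [← map_zero (of : Q.WordAlgebra →L[ℂ] Q.OA), ← of_mul, mul_zero]

theorem mul_assoc' (a b c : Q.OA) : a * b * c = a * (b * c) := by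
  induction a using OA.induction_on with
  | hp => exact isClosed_eq (Continuous.mul (Continuous.mul continuous_id continuous_const) continuous_const) (Continuous.mul continuous_id continuous_const)
  | h x =>
  induction b using OA.induction_on with
  | hp => exact isClosed_eq (Continuous.mul (Continuous.mul continuous_const continuous_id) continuous_const) (Continuous.mul continuous_const (Continuous.mul continuous_id continuous_const))
  | h y =>
  induction c using OA.induction_on with
  | hp => exact isClosed_eq (Continuous.mul continuous_const continuous_id) (Continuous.mul continuous_const (Continuous.mul continuous_const continuous_id))
  | h z => simp only [← of_mul, mul_assoc]

theorem mul_add' (a b c : Q.OA) : a * (b + c) = a * b + a * c := by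
  induction a using OA.induction_on with
  | hp => exact isClosed_eq (Continuous.mul continuous_id continuous_const) (Continuous.add (Continuous.mul continuous_id continuous_const) (Continuous.mul continuous_id continuous_const))
  | h x =>
  induction b using OA.induction_on with
  | hp => exact isClosed_eq (Continuous.mul continuous_const (Continuous.add continuous_id continuous_const)) (Continuous.add (Continuous.mul continuous_const continuous_id) continuous_const)
  | h y =>
  induction c using OA.induction_on with
  | hp => exact isClosed_eq (Continuous.mul continuous_const (Continuous.add continuous_const continuous_id)) (Continuous.add continuous_const (Continuous.mul continuous_const continuous_id))
  | h z => simp only [← of_mul, ← map_add, mul_add]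

theorem add_mul' (a b c : Q.OA) : (a + b) * c = a * c + b * c := by
  induction a using OA.induction_on with
  | hp => exact isClosed_eq (Continuous.mul (Continuous.add continuous_id continuous_const) continuous_const) (Continuous.add (Continuous.mul continuous_id continuous_const) continuous_const)
  | h x =>
  induction b using OA.induction_on with
  | hp => exact isClosed_eq (Continuous.mul (Continuous.add continuous_const continuous_id) continuous_const) (Continuous.add continuous_const (Continuous.mul continuous_id continuous_const))
  | h y =>
  induction c using OA.induction_on with
  | hp => exact isClosed_eq (Continuous.mul continuous_const continuous_id) (Continuous.add (Continuous.mul continuous_const continuous_id) (Continuous.mul continuous_const continuous_id))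
  | h z => simp only [← of_mul, ← map_add, add_mul]

theorem norm_mul_le' (a b : Q.OA) : ‖a * b‖ ≤ ‖a‖ * ‖b‖ := by
  induction a using OA.induction_on with
  | hp => exact isClosed_le (Continuous.norm (Continuous.mul continuous_id continuous_const)) (Continuous.mul (Continuous.norm continuous_id) continuous_const)
  | h x =>
  induction b using OA.induction_on with
  | hp => exact isClosed_le (Continuous.norm (Continuous.mul continuous_const continuous_id)) (Continuous.mul continuous_const (Continuous.norm continuous_id))
  | h y =>
    rw [← of_mul, norm_of, norm_of, norm_of]
    exact norm_mul_le x y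

theorem smul_mul_assoc' (c : ℂ) (a b : Q.OA) : c • a * b = c • (a * b) := by
  induction a using OA.induction_on with
  | hp => exact isClosed_eq (Continuous.mul (Continuous.const_smul continuous_id c) continuous_const) (Continuous.const_smul (Continuous.mul continuous_id continuous_const) c)
  | h x =>
  induction b using OA.induction_on with
  | hp => exact isClosed_eq (Continuous.mul continuous_const continuous_id) (Continuous.const_smul (Continuous.mul continuous_const continuous_id) c)
  | h y => simp only [← of_mul, ← map_smul, smul_mul_assoc]

theorem mul_smul_comm' (c : ℂ) (a b : Q.OA) : a * c • b = c • (a * b) := by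
  induction a using OA.induction_on with
  | hp => exact isClosed_eq (Continuous.mul continuous_id continuous_const) (Continuous.const_smul (Continuous.mul continuous_id continuous_const) c)
  | h x =>
  induction b using OA.induction_on with
  | hp => exact isClosed_eq (Continuous.mul continuous_const (Continuous.const_smul continuous_id c)) (Continuous.const_smul (Continuous.mul continuous_const continuous_id) c)
  | h y => simp only [← of_mul, ← map_smul, mul_smul_comm]

end Algebra

instance : NonUnitalNormedRing Q.OA :=
  { (inferInstance : NormedAddCommGroup Q.OA), (inferInstance : Mul Q.OA) with
    zero_mul := zero_mul'
    mul_zero := mul_zero'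
    mul_assoc := mul_assoc'
    left_distrib := mul_add'
    right_distrib := add_mul'
    norm_mul_le := norm_mul_le' }

instance : IsScalarTower ℂ Q.OA Q.OA := ⟨smul_mul_assoc'⟩

instance : SMulCommClass ℂ Q.OA Q.OA := ⟨fun c a b => (mul_smul_comm' c a b).symm⟩

end OA

/-- The maximal ideal space of `OA(Q)`: the nonzero multiplicative (continuous) linear functionals,
with the weak-star topology. -/
abbrev MaximalIdealSpace : Type (max u v) := WeakDual.characterSpace ℂ Q.OA

/-- The edges with both range and source in `S`. -/
def edgesWithin (S : Set V) : Set E := {e | Q.r e ∈ S ∧ Q.s e ∈ S}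

/-- The number `n(S)` of edges with both range and source in `S` (for a finite graph). -/
def numEdgesWithin (S : Set V) : ℕ := (Q.edgesWithin S).ncard

end

/-- The closed polydisc: the product of `k` copies of the closed unit disc of `ℂ`. -/
abbrev Polydisc (k : ℕ) : Type := Fin k → Metric.closedBall (0 : ℂ) 1

end DirectedGraph

/-! A character of `OA(Q)` is a one-dimensional contractive representation of `Q`. Its values on
letters determine it, because letters generate a dense subalgebra. A vertex is idempotent, so its
value is 0 or 1; an edge has value of modulus at most 1, because characters are contractive
(`MaximalIdealSpace.norm_apply_le`). Let `S` be the set of vertices with value 1. The relations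
`r(e) e = e = e s(e)` force the value 0 on every edge not within `S`, and `S` is nonempty, since
otherwise all letters would be sent to 0. Conversely, 1 on `S` together with arbitrary disc values
on the edges within `S` defines scalar operators on any Hilbert space. The resulting functional on
`ℂ w(Q)` is therefore dominated by the universal norm (`IsWeight.norm_onAlgebra_le`) and extends to
`OA(Q)`. This gives a bijection from the disjoint union of polydiscs onto the characters. It is
continuous from a compact space to a Hausdorff one, hence a homeomorphism. -/

namespace DirectedGraph

noncomputable section

variable {V : Type u} {E : Type v} {Q : DirectedGraph V E}

/-! ### Letters in the word algebra -/

/-- The element of `ℂ w(Q)` given by a vertex or an edge. -/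
def letter (x : V ⊕ E) : Q.WordAlgebra :=
  (MonoidAlgebra.single (FreeSemigroup.of x : Q.Words) (1 : ℂ) : MonoidAlgebra ℂ Q.Words)

theorem letter_mul_letter (x y : V ⊕ E) : (letter x * letter y : Q.WordAlgebra) =
    (MonoidAlgebra.single ((FreeSemigroup.of x * FreeSemigroup.of y : FreeSemigroup (V ⊕ E)) :
      Q.Words) (1 : ℂ) : MonoidAlgebra ℂ Q.Words) := by
  refine (MonoidAlgebra.single_mul_single _ _ _ _).trans ?_
  rw [mul_one, Con.coe_mul]

theorem letter_range_mul (x : V ⊕ E) :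
    (letter (.inl (Q.range x)) * letter x : Q.WordAlgebra) = letter x := by
  rw [letter_mul_letter, letter]
  congr 1
  exact (Con.eq _).2 (ConGen.Rel.of _ _ (.range_mul x))

theorem letter_mul_source (x : V ⊕ E) :
    (letter x * letter (.inl (Q.source x)) : Q.WordAlgebra) = letter x := by
  rw [letter_mul_letter, letter]
  congr 1
  exact (Con.eq _).2 (ConGen.Rel.of _ _ (.mul_source x))

/-- The universal norm is dominated by the `ℓ¹` norm of the coefficients. This yields the bound 1
for a character on edges. -/
theorem norm_letter_le (x : V ⊕ E) : ‖(letter x : Q.WordAlgebra)‖ ≤ 1 := by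
  refine Q.universalNorm_le fun H _ _ _ π => (π.norm_onAlgebra_le _).trans ?_
  simp [letter]

/-- Multiplicative linear functionals on `ℂ w(Q)` are determined by their values on letters. -/
theorem WordAlgebra.hom_ext {φ ψ : Q.WordAlgebra →ₙₐ[ℂ] ℂ}
    (h : ∀ x, φ (letter x) = ψ (letter x)) : φ = ψ := by
  refine MonoidAlgebra.nonUnitalAlgHom_ext ℂ (φ₁ := φ) (φ₂ := ψ) fun w => ?_
  induction w using Con.induction_on with
  | H w =>
    induction w with
    | ih1 x => exact h x
    | ih2 x y hx hy =>
      have key : (MonoidAlgebra.single ((FreeSemigroup.of x * y : FreeSemigroup (V ⊕ E)) : Q.Words)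
          (1 : ℂ)) = MonoidAlgebra.single (FreeSemigroup.of x : Q.Words) (1 : ℂ) *
            MonoidAlgebra.single (y : Q.Words) (1 : ℂ) := by
        rw [MonoidAlgebra.single_mul_single, mul_one, Con.coe_mul]
      rw [key]
      exact (map_mul φ _ _).trans ((congrArg₂ _ hx hy).trans (map_mul ψ _ _).symm)

/-! ### One-dimensional representations and the characters they induce -/

variable (Q) in
/-- The values on letters of the one-dimensional contractive representations of `Q`. -/
structure IsWeight (f : V ⊕ E → ℂ) : Prop where
  eq_zero_or_one (v : V) : f (.inl v) = 0 ∨ f (.inl v) = 1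
  norm_le_one (e : E) : ‖f (.inr e)‖ ≤ 1
  range_mul (e : E) : f (.inl (Q.r e)) * f (.inr e) = f (.inr e)
  mul_source (e : E) : f (.inr e) * f (.inl (Q.s e)) = f (.inr e)

namespace IsWeight

variable {f : V ⊕ E → ℂ} (hf : Q.IsWeight f)

/-- The contractive representation of `Q` by scalar operators. -/
def scalarRep (H : Type w) [NormedAddCommGroup H] [InnerProductSpace ℂ H] [CompleteSpace H] :
    Q.ContractiveRep H where
  P v := f (.inl v) • 1
  T e := f (.inr e) • 1
  isStarProjection v := by
    rcases hf.eq_zero_or_one v with h | h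
    · simp [h]
    · simp [h]
  norm_le_one e := by
    rw [norm_smul]
    -- Only `‖1‖ ≤ 1` is available, since `H` may be trivial.
    exact mul_le_one₀ (hf.norm_le_one e) (norm_nonneg _) ContinuousLinearMap.norm_id_le
  range_mul e := by rw [smul_mul_smul_comm, hf.range_mul, mul_one]
  mul_source e := by rw [smul_mul_smul_comm, hf.mul_source, mul_one]

theorem wordCon_le (hf : Q.IsWeight f) : Q.wordCon ≤ Con.ker (FreeSemigroup.lift f) := by
  refine Con.conGen_le.2 ?_
  rintro _ _ (⟨v | e⟩ | ⟨v | e⟩)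
  · rcases hf.eq_zero_or_one v with h | h <;> simp [Con.ker_rel, range, h]
  · simpa [Con.ker_rel, range] using hf.range_mul e
  · rcases hf.eq_zero_or_one v with h | h <;> simp [Con.ker_rel, source, h]
  · simpa [Con.ker_rel, source] using hf.mul_source e

/-- The multiplicative functional on `w(Q)` with the given values on letters. -/
def onWords : Q.Words →ₙ* ℂ where
  toFun x := Con.liftOn x (FreeSemigroup.lift f) fun _ _ h => hf.wordCon_le h
  map_mul' x y := Con.induction_on₂ x y fun a b => map_mul (FreeSemigroup.lift f) a b

/-- The multiplicative functional on `ℂ w(Q)` with the given values on letters. -/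
def onAlgebra : Q.WordAlgebra →ₙₐ[ℂ] ℂ :=
  (MonoidAlgebra.liftMagma ℂ hf.onWords : MonoidAlgebra ℂ Q.Words →ₙₐ[ℂ] ℂ)

theorem onAlgebra_single (w : Q.Words) (c : ℂ) :
    hf.onAlgebra (MonoidAlgebra.single w c : MonoidAlgebra ℂ Q.Words) = c * hf.onWords w := by
  change MonoidAlgebra.liftMagma ℂ hf.onWords (MonoidAlgebra.single w c) = _
  simp [MonoidAlgebra.liftMagma_apply_apply]

theorem onAlgebra_letter (x : V ⊕ E) : hf.onAlgebra (letter x) = f x := by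
  rw [letter, onAlgebra_single, one_mul]
  exact FreeSemigroup.lift_of f x

theorem scalarRep_eval (H : Type w) [NormedAddCommGroup H] [InnerProductSpace ℂ H]
    [CompleteSpace H] (x : Q.WordAlgebra) : (hf.scalarRep H).eval x = hf.onAlgebra x • 1 := by
  have hw (w : Q.Words) : (hf.scalarRep H).onWords w = hf.onWords w • 1 := by
    induction w using Con.induction_on with
    | H w =>
      change (hf.scalarRep H).onFree w = FreeSemigroup.lift f w • 1
      induction w with
      | ih1 x => rcases x with v | e <;> simp [ContractiveRep.onFree, scalarRep]
      | ih2 x y hx hy => rw [map_mul, map_mul, hx, hy, smul_mul_smul_comm, mul_one]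
  have hx (y : MonoidAlgebra ℂ Q.Words) :
      MonoidAlgebra.liftMagma ℂ (hf.scalarRep H).onWords y =
        MonoidAlgebra.liftMagma ℂ hf.onWords y • 1 := by
    simp [MonoidAlgebra.liftMagma_apply_apply, Finsupp.sum, Finset.sum_smul, hw, smul_smul]
  exact hx x

/-- Up to the identification of scalars with operators on a line, the functional is itself one of
the representations in the supremum. -/
theorem norm_onAlgebra_le (x : Q.WordAlgebra) : ‖hf.onAlgebra x‖ ≤ ‖x‖ := by
  -- A one-dimensional Hilbert space, placed in the universe over which the universal norm is taken;
  -- being nontrivial, it has `‖1‖ = 1`.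
  have h := (hf.scalarRep (EuclideanSpace ℂ PUnit.{max u v + 1})).norm_eval_le x
  rwa [scalarRep_eval, norm_smul, norm_one, mul_one] at h

/-- The continuous multiplicative functional on `OA(Q)` with the given values on letters. -/
def onOA : Q.OA →L[ℂ] ℂ :=
  ((hf.onAlgebra : Q.WordAlgebra →ₗ[ℂ] ℂ).mkContinuous 1 fun x => by
    simpa using hf.norm_onAlgebra_le x).extend OA.of

theorem onOA_of (x : Q.WordAlgebra) : hf.onOA (OA.of x) = hf.onAlgebra x :=
  ContinuousLinearMap.extend_eq _ (OA.isDenseInducing_of Q).dense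
    (UniformSpace.Completion.isUniformInducing_coe Q.WordAlgebra) x

theorem onOA_letter (x : V ⊕ E) : hf.onOA (OA.of (letter x)) = f x := by
  rw [onOA_of, onAlgebra_letter]

/-- The bound does not depend on `f`, which makes approximation by elements of `ℂ w(Q)` uniform over
all weights. -/
theorem norm_onOA_apply_le (a : Q.OA) : ‖hf.onOA a‖ ≤ ‖a‖ := by
  induction a using OA.induction_on with
  | hp => exact isClosed_le hf.onOA.continuous.norm continuous_norm
  | h x => rw [onOA_of, OA.norm_of]; exact hf.norm_onAlgebra_le x

theorem onOA_mul (a b : Q.OA) : hf.onOA (a * b) = hf.onOA a * hf.onOA b := by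
  induction a using OA.induction_on with
  | hp => exact isClosed_eq (by fun_prop) (by fun_prop)
  | h x =>
  induction b using OA.induction_on with
  | hp => exact isClosed_eq (by fun_prop) (by fun_prop)
  | h y => rw [← OA.of_mul, onOA_of, onOA_of, onOA_of, map_mul]

/-- The functionals on `OA(Q)` depend continuously on their values on letters. -/
theorem continuous_onOA_apply {Z : Type*} [TopologicalSpace Z] {F : Z → V ⊕ E → ℂ}
    (hF : ∀ z, Q.IsWeight (F z)) (hc : Continuous F) (a : Q.OA) :
    Continuous fun z => (hF z).onOA a := by
  have hwords (w : Q.Words) : Continuous fun z => (hF z).onWords w := by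
    induction w using Con.induction_on with
    | H w =>
      change Continuous fun z => FreeSemigroup.lift (F z) w
      induction w with
      | ih1 x => exact ((continuous_apply x).comp hc).congr fun z =>
          (FreeSemigroup.lift_of (F z) x).symm
      | ih2 x y hx hy => exact (hx.mul hy).congr fun z =>
          (map_mul (FreeSemigroup.lift (F z)) _ _).symm
  have halg (x : Q.WordAlgebra) : Continuous fun z => (hF z).onAlgebra x := by
    refine MonoidAlgebra.induction_linear
      (motive := fun x => Continuous fun z => (hF z).onAlgebra x) x ?_ ?_ ?_
    · exact continuous_const.congr fun z => (map_zero (hF z).onAlgebra).symm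
    · exact fun x y hx hy => (hx.add hy).congr fun z => (map_add (hF z).onAlgebra x y).symm
    · exact fun w c => (continuous_const.mul (hwords w)).congr fun z =>
        ((hF z).onAlgebra_single w c).symm
  -- Since all the functionals are contractive, replacing `a` by an `ε`-close element of `ℂ w(Q)`
  -- moves the values by less than `ε`, uniformly in `z`.
  refine continuous_of_uniform_approx_of_continuous fun s hs => ?_
  obtain ⟨ε, hε, hs⟩ := Metric.mem_uniformity_dist.1 hs
  obtain ⟨x, hx⟩ := Metric.denseRange_iff.1 (OA.isDenseInducing_of Q).dense a ε hε
  refine ⟨fun z => (hF z).onAlgebra x, halg x, fun z => hs ?_⟩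
  change dist _ ((hF z).onAlgebra x) < ε
  rw [← onOA_of, dist_eq_norm, ← map_sub]
  exact ((hF z).norm_onOA_apply_le _).trans_lt (by rwa [← dist_eq_norm])

/-- The point of the maximal ideal space with the given values on letters. -/
def character (h0 : f ≠ 0) : Q.MaximalIdealSpace :=
  ⟨(hf.onOA : Q.OA →L[ℂ] ℂ), fun h => h0 <| funext fun x => by
    rw [← hf.onOA_letter x]
    exact DFunLike.congr_fun h _, hf.onOA_mul⟩

end IsWeight

/-! ### Values of an arbitrary character on letters -/

namespace MaximalIdealSpace

theorem ext_letter {φ ψ : Q.MaximalIdealSpace}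
    (h : ∀ x, φ (OA.of (letter x)) = ψ (OA.of (letter x))) : φ = ψ := by
  let restrict (χ : Q.MaximalIdealSpace) : Q.WordAlgebra →ₙₐ[ℂ] ℂ :=
    { toFun := fun x => χ (OA.of x)
      map_smul' := fun c x => by simp
      map_zero' := by simp
      map_add' := fun x y => by simp
      map_mul' := fun x y => by rw [OA.of_mul, map_mul] }
  have key : restrict φ = restrict ψ := WordAlgebra.hom_ext h
  refine WeakDual.CharacterSpace.ext fun a => ?_
  induction a using OA.induction_on with
  | hp => exact isClosed_eq (map_continuous φ) (map_continuous ψ)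
  | h x => exact DFunLike.congr_fun key x

/-- Squaring works without a unit: `|φ a|² = |φ (a * a)| ≤ ‖φ‖ ‖a‖²` gives `‖φ‖² ≤ ‖φ‖`. -/
theorem norm_apply_le (φ : Q.MaximalIdealSpace) (a : Q.OA) : ‖φ a‖ ≤ ‖a‖ := by
  let ψ : Q.OA →L[ℂ] ℂ := WeakDual.CharacterSpace.toCLM φ
  have hψ : ‖ψ‖ ≤ √‖ψ‖ := by
    refine ψ.opNorm_le_bound (Real.sqrt_nonneg _) fun a => ?_
    refine le_of_sq_le_sq ?_ (by positivity)
    calc ‖ψ a‖ ^ 2 = ‖ψ (a * a)‖ := by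
          rw [sq, ← norm_mul]; exact congrArg _ (map_mul φ a a).symm
      _ ≤ ‖ψ‖ * ‖a * a‖ := ψ.le_opNorm _
      _ ≤ ‖ψ‖ * (‖a‖ * ‖a‖) := by gcongr; exact norm_mul_le a a
      _ = (√‖ψ‖ * ‖a‖) ^ 2 := by rw [mul_pow, Real.sq_sqrt (norm_nonneg _), sq ‖a‖]
  have h1 : ‖ψ‖ ≤ 1 := by
    by_contra! h
    nlinarith [Real.sq_sqrt (norm_nonneg ψ), Real.sqrt_nonneg ‖ψ‖]
  exact (ψ.le_opNorm a).trans (mul_le_of_le_one_left (norm_nonneg a) h1)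

/-- The values of a character on letters. -/
def weight (φ : Q.MaximalIdealSpace) (x : V ⊕ E) : ℂ := φ (OA.of (letter x))

theorem weight_range_mul (φ : Q.MaximalIdealSpace) (x : V ⊕ E) :
    weight φ (.inl (Q.range x)) * weight φ x = weight φ x := by
  rw [weight, weight, ← map_mul, ← OA.of_mul, letter_range_mul]

theorem weight_mul_source (φ : Q.MaximalIdealSpace) (x : V ⊕ E) :
    weight φ x * weight φ (.inl (Q.source x)) = weight φ x := by
  rw [weight, weight, ← map_mul, ← OA.of_mul, letter_mul_source]

theorem isWeight_weight (φ : Q.MaximalIdealSpace) : Q.IsWeight (weight φ) where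
  -- As `range` fixes vertices, the relation here says that the value is idempotent in `ℂ`.
  eq_zero_or_one v := IsIdempotentElem.iff_eq_zero_or_one.1 (weight_range_mul φ (.inl v))
  norm_le_one _ := (norm_apply_le φ _).trans ((OA.norm_of _).trans_le (norm_letter_le _))
  range_mul e := weight_range_mul φ (.inr e)
  mul_source e := weight_mul_source φ (.inr e)

/-- Every letter absorbs its range vertex, so a character vanishing on all vertices vanishes on all
letters, hence on a dense subalgebra. -/
theorem exists_weight_vertex_eq_one (φ : Q.MaximalIdealSpace) : ∃ v, weight φ (.inl v) = 1 := by
  by_contra! h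
  have h0 (v : V) : weight φ (.inl v) = 0 :=
    ((isWeight_weight φ).eq_zero_or_one v).resolve_right (h v)
  refine φ.2.1 (DFunLike.ext _ _ fun a => ?_)
  have hz (x : V ⊕ E) : φ (OA.of (letter x)) = 0 := by
    change weight φ x = 0
    rw [← weight_range_mul, h0, zero_mul]
  let restrict : Q.WordAlgebra →ₙₐ[ℂ] ℂ :=
    { toFun := fun x => φ (OA.of x)
      map_smul' := fun c x => by simp
      map_zero' := by simp
      map_add' := fun x y => by simp
      map_mul' := fun x y => by rw [OA.of_mul, map_mul] }
  have key : restrict = 0 := WordAlgebra.hom_ext hz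
  change φ a = 0
  induction a using OA.induction_on with
  | hp => exact isClosed_eq (map_continuous φ) continuous_const
  | h x => exact DFunLike.congr_fun key x

end MaximalIdealSpace

/-! ### The bijection between polydiscs and characters -/

section Polydisc

variable [Finite E]

variable (Q) in
/-- An enumeration of the edges within `S`. -/
def edgesWithinEquiv (S : Set V) : Q.edgesWithin S ≃ Fin (Q.numEdgesWithin S) :=
  Finite.equivFinOfCardEq rfl

open Classical in
/-- The values on letters of the one-dimensional representation that is `1` on the vertices in `S`
and given by a point of the polydisc on the edges within `S`. -/
def polydiscWeight (S : Set V) (z : Polydisc (Q.numEdgesWithin S)) : V ⊕ E → ℂ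
  | .inl v => if v ∈ S then 1 else 0
  | .inr e => if h : e ∈ Q.edgesWithin S then z (Q.edgesWithinEquiv S ⟨e, h⟩) else 0

theorem isWeight_polydiscWeight (S : Set V) (z : Polydisc (Q.numEdgesWithin S)) :
    Q.IsWeight (polydiscWeight S z) where
  eq_zero_or_one v := by
    by_cases h : v ∈ S <;> simp [polydiscWeight, h]
  norm_le_one e := by
    by_cases h : e ∈ Q.edgesWithin S
    · simpa only [polydiscWeight, h, dite_true] using
        mem_closedBall_zero_iff.1 (z (Q.edgesWithinEquiv S ⟨e, h⟩)).2
    · simp [polydiscWeight, h]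
  range_mul e := by
    by_cases h : e ∈ Q.edgesWithin S
    · simp [polydiscWeight, h, h.1]
    · simp [polydiscWeight, h]
  mul_source e := by
    by_cases h : e ∈ Q.edgesWithin S
    · simp [polydiscWeight, h, h.2]
    · simp [polydiscWeight, h]

theorem continuous_polydiscWeight (S : Set V) :
    Continuous (polydiscWeight S : Polydisc (Q.numEdgesWithin S) → V ⊕ E → ℂ) := by
  refine continuous_pi ?_
  rintro (v | e)
  · exact continuous_const
  · by_cases h : e ∈ Q.edgesWithin S
    · simp only [polydiscWeight, h, dite_true]
      fun_prop
    · simpa [polydiscWeight, h] using continuous_const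

theorem polydiscWeight_ne_zero {S : Set V} (hS : S.Nonempty)
    (z : Polydisc (Q.numEdgesWithin S)) : polydiscWeight S z ≠ 0 := by
  obtain ⟨v, hv⟩ := hS
  intro h
  simpa [polydiscWeight, hv] using congrFun h (.inl v)

variable (Q) in
/-- The character of `OA(Q)` given by a set of vertices and a point of the polydisc. -/
def polydiscCharacter
    (p : Σ S : {S : Set V // S.Nonempty}, Polydisc (Q.numEdgesWithin S.1)) : Q.MaximalIdealSpace :=
  (isWeight_polydiscWeight p.1.1 p.2).character (polydiscWeight_ne_zero p.1.2 p.2)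

theorem weight_polydiscCharacter
    (p : Σ S : {S : Set V // S.Nonempty}, Polydisc (Q.numEdgesWithin S.1)) :
    MaximalIdealSpace.weight (Q.polydiscCharacter p) = polydiscWeight p.1.1 p.2 :=
  funext fun x => (isWeight_polydiscWeight p.1.1 p.2).onOA_letter x

theorem continuous_polydiscCharacter : Continuous Q.polydiscCharacter := by
  refine continuous_sigma fun S => Continuous.subtype_mk ?_ _
  exact WeakDual.continuous_of_continuous_eval fun a =>
    IsWeight.continuous_onOA_apply (isWeight_polydiscWeight S.1) (continuous_polydiscWeight S.1) a

theorem polydiscCharacter_injective : Function.Injective Q.polydiscCharacter := by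
  rintro ⟨⟨S, hS⟩, z⟩ ⟨⟨S', hS'⟩, z'⟩ h
  have hw : polydiscWeight S z = polydiscWeight S' z' := by
    have := congrArg MaximalIdealSpace.weight h
    rwa [weight_polydiscCharacter, weight_polydiscCharacter] at this
  -- The vertex values are the indicator function of the set, so they recover it.
  obtain rfl : S = S' := by
    ext v
    have := congrFun hw (.inl v)
    by_cases h1 : v ∈ S <;> by_cases h2 : v ∈ S' <;> simp_all [polydiscWeight]
  congr 1
  funext i
  obtain ⟨⟨e, he⟩, rfl⟩ := (Q.edgesWithinEquiv S).surjective i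
  have := congrFun hw (.inr e)
  simpa [polydiscWeight, he, Subtype.ext_iff] using this

theorem polydiscCharacter_surjective : Function.Surjective Q.polydiscCharacter := by
  intro φ
  have hφ := MaximalIdealSpace.isWeight_weight φ
  let S : Set V := {v | MaximalIdealSpace.weight φ (.inl v) = 1}
  have hS : S.Nonempty := MaximalIdealSpace.exists_weight_vertex_eq_one φ
  have h0 {v : V} (hv : v ∉ S) : MaximalIdealSpace.weight φ (.inl v) = 0 :=
    (hφ.eq_zero_or_one v).resolve_right hv
  let z : Polydisc (Q.numEdgesWithin S) := fun i =>
    ⟨MaximalIdealSpace.weight φ (.inr ((Q.edgesWithinEquiv S).symm i)), by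
      simpa using hφ.norm_le_one _⟩
  refine ⟨⟨⟨S, hS⟩, z⟩, MaximalIdealSpace.ext_letter fun x => ?_⟩
  refine (congrFun (weight_polydiscCharacter ⟨⟨S, hS⟩, z⟩) x).trans ?_
  change polydiscWeight S z x = MaximalIdealSpace.weight φ x
  rcases x with v | e
  · by_cases hv : v ∈ S
    · simpa [polydiscWeight, hv] using hv.symm
    · simp [polydiscWeight, hv, h0 hv]
  · by_cases he : e ∈ Q.edgesWithin S
    · simp [polydiscWeight, he, z]
    · have : Q.r e ∉ S ∨ Q.s e ∉ S := not_and_or.1 he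
      rcases this with h | h
      · rw [← hφ.range_mul, h0 h, zero_mul]
        simp [polydiscWeight, he]
      · rw [← hφ.mul_source, h0 h, mul_zero]
        simp [polydiscWeight, he]

end Polydisc

end

end DirectedGraph

theorem proposition5 {V : Type*} {E : Type*} [Finite V] [Finite E] (Q : DirectedGraph V E) :
    Nonempty (Q.MaximalIdealSpace ≃ₜ
      (Σ S : {S : Set V // S.Nonempty}, DirectedGraph.Polydisc (Q.numEdgesWithin S.1))) :=
  -- The domain is compact because finiteness of `V` leaves finitely many sets `S`, each
  -- contributing a compact polydisc; the weak-* topology is Hausdorff.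
  ⟨(Continuous.homeoOfEquivCompactToT2
    (f := Equiv.ofBijective Q.polydiscCharacter
      ⟨DirectedGraph.polydiscCharacter_injective, DirectedGraph.polydiscCharacter_surjective⟩)
    DirectedGraph.continuous_polydiscCharacter).symm⟩
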